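/- **Setting.** For $n\ge 1$ and a square-summable sequence $\theta=(\theta_1,\theta_2,\dots)$ let $P_\theta^{(n)}=\bigotimes_{j\ge1}N(\theta_j,1/n)$ be the law of the observation $X^n=(X_1,X_2,\dots)$ in the Gaussian sequence model. For $\alpha,Q>0$ let $E_\alpha(Q)=\{\theta:\sum_{j\ge 1}j^{2\alpha}\theta_j^2\le Q^2\}$ and $\epsilon_n^2=n^{-2\alpha/(2\alpha+1)}$, so that $n\epsilon_n^2=n^{1/(2\alpha+1)}$. Given a probability mass function $\pi$ on $\{0,1,2,\dots\}$ and a positive probability density $g$ on $\mathbb R$, the sieve prior $\Pi$ is the law of $(k,\theta)$ where $k\sim\pi$ and, given $k$, the variables $\sqrt n\,\theta_j$, $1\le j\le k$, are i.i.d. with density $g$, and $\theta_j=0$ for $j>k$. The posterior is $$\Pi(A\mid X^n)=\frac{\int_A \frac{dP_\theta^{(n)}}{dP_0^{(n)}}(X^n)\,d\Pi(k,\theta)}{\int \frac{dP_\theta^{(n)}}{dP_0^{(n)}}(X^n)\,d\Pi(k,\theta)}.$$ **Theorem.** Let $\alpha,Q>0$, $c\in(0,1)$ and $C>0$. There are constants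 $M,C'>0$, depending only on $(\alpha,Q,c,C)$, such that the following holds for every $n\ge1$ and all $\pi$ and $g$ satisfying - $\pi(j)\le c\,\pi(j-1)$ for all $j\ge 2$ (no condition is imposed on $\pi(0)$, which may be $0$); - $\pi(J)>0$ and $-\log\pi(J)\le C n^{1/(2\alpha+1)}$, where $J=\lfloor n^{1/(2\alpha+1)}\rfloor$; - $|\log g(x)-\log g(y)|\le C(1+|x-y|)$ for all $x,y\in\mathbb R$, and $|\log g(0)|\le C$. For every $\theta_0\in E_\alpha(Q)$, writing $P_{\theta_0}^{(n)}$ also for the expectation under $X^n\sim P_{\theta_0}^{(n)}$, $$P_{\theta_0}^{(n)}\,\Pi\big(k>M n^{1/(2\alpha+1)}\,\big|\,X^n\big)\le \exp(-C'n\epsilon_n^2),$$ $$P_{\theta_0}^{(n)}\,\Pi\big(\|\theta-\theta_0\|^2\ge M\epsilon_n^2\,\big|\,X^n\big)\le \exp(-C'n\epsilon_n^2).$$ In particular the prior is adaptive: $\pi$ and $g$ need not depend on $\alpha$, and the bounds hold at every $\alpha>0$ for which the conditions are met. -/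

import Mathlib

open MeasureTheory ProbabilityTheory
open scoped ENNReal NNReal

noncomputable section

namespace GaussianSequence

/-!
Sequences `(θ_1, θ_2, …)` are functions `ℕ → ℝ`: the coordinate `θ_j` of the mathematical text
(`j ≥ 1`) is `θ (j - 1)`, so "the first `k` coordinates" are those with Lean index `i < k`.
-/

/-- The Sobolev ball `E_α(Q) = {θ : ∑_{j ≥ 1} j^{2α} θ_j² ≤ Q²}`. -/
def sobolevBall (α Q : ℝ) : Set (ℕ → ℝ) :=
  {θ | Summable (fun i : ℕ => ((i : ℝ) + 1) ^ (2 * α) * θ i ^ 2) ∧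
    ∑' i : ℕ, ((i : ℝ) + 1) ^ (2 * α) * θ i ^ 2 ≤ Q ^ 2}

/-- The law `P_θ^{(n)} = ⨂_i N(θ_i, 1/n)` of the observation `X^n = (X_1, X_2, …)` in the Gaussian
sequence model (meaningful for `n ≥ 1`). -/
def law (n : ℕ) (θ : ℕ → ℝ) : Measure (ℕ → ℝ) :=
  Measure.infinitePi (fun i => gaussianReal (θ i) ((n : ℝ≥0)⁻¹))

/-- The squared minimax rate `ε_n² = n^{-2α/(2α+1)}`. -/
def rateSq (α : ℝ) (n : ℕ) : ℝ := (n : ℝ) ^ (-(2 * α / (2 * α + 1)))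

/-- The effective dimension `n^{1/(2α+1)}` (a real number). -/
def effDim (α : ℝ) (n : ℕ) : ℝ := (n : ℝ) ^ (1 / (2 * α + 1))

/-- `‖θ - θ'‖²`, the squared `ℓ²`-distance, with values in `[0, ∞]`. -/
def sqDist (θ θ' : ℕ → ℝ) : ℝ≥0∞ := ∑' i, ENNReal.ofReal ((θ i - θ' i) ^ 2)

/-- `g` is a probability density on the real line that is positive everywhere. -/
structure IsPosDensity (g : ℝ → ℝ) : Prop where
  measurable : Measurable g
  pos : ∀ x, 0 < g x
  lintegral_eq_one : ∫⁻ x, ENNReal.ofReal (g x) = 1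

/-- The law of one active coefficient `ϑ`, where `√n ϑ` has density `g`. -/
def coordPrior (n : ℕ) (g : ℝ → ℝ) : Measure ℝ :=
  (volume.withDensity (fun x => ENNReal.ofReal (g x))).map (fun x => x / √(n : ℝ))

/-- The sequence whose first `k` coordinates are `t` and whose other coordinates vanish. -/
def extendZero (k : ℕ) (t : Fin k → ℝ) : ℕ → ℝ :=
  fun i => if h : i < k then t ⟨i, h⟩ else 0

/-- The prior on `θ` given the dimension `k`: the first `k` coefficients are i.i.d. with
law `coordPrior n g`, and all others are zero. -/
def condPrior (n : ℕ) (g : ℝ → ℝ) (k : ℕ) : Measure (ℕ → ℝ) :=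
  (Measure.pi (fun _ : Fin k => coordPrior n g)).map (extendZero k)

/-- The sieve prior, as the joint law of `(k, θ)`: `k ∼ π`, and given `k` the
sequence `θ` has law `condPrior n g k`. -/
def sievePrior (n : ℕ) (π : PMF ℕ) (g : ℝ → ℝ) : Measure (ℕ × (ℕ → ℝ)) :=
  Measure.sum (fun k => π k • (condPrior n g k).map (fun θ => (k, θ)))

/-- The likelihood of `(k, θ)`, where `θ_j = 0` for `j > k`: the density at the observation `x`
of `P_θ^{(n)}` with respect to the dominating measure `P_0^{(n)}`
(see `law_eq_withDensity_likelihood`). -/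
def likelihood (n : ℕ) (p : ℕ × (ℕ → ℝ)) (x : ℕ → ℝ) : ℝ≥0∞ :=
  ENNReal.ofReal (Real.exp (∑ i ∈ Finset.range p.1, (n : ℝ) * (p.2 i * x i - p.2 i ^ 2 / 2)))

/-- The posterior probability `Π(A | X^n = x)` by Bayes' formula. -/
def posterior (n : ℕ) (π : PMF ℕ) (g : ℝ → ℝ) (A : Set (ℕ × (ℕ → ℝ))) (x : ℕ → ℝ) : ℝ≥0∞ :=
  (∫⁻ p in A, likelihood n p x ∂(sievePrior n π g)) / ∫⁻ p, likelihood n p x ∂(sievePrior n π g)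

theorem gaussianReal_eq_withDensity (n : ℕ) (hn : 1 ≤ n) (m : ℝ) :
    gaussianReal m ((n : ℝ≥0)⁻¹) = (gaussianReal 0 ((n : ℝ≥0)⁻¹)).withDensity
      (fun x => ENNReal.ofReal (Real.exp ((n : ℝ) * (m * x - m ^ 2 / 2)))) := by
  have hn' : (n : ℝ) ≠ 0 := by positivity
  have hv : ((n : ℝ≥0)⁻¹) ≠ 0 := by
    have : (n : ℝ≥0) ≠ 0 := by positivity
    exact inv_ne_zero this
  rw [gaussianReal_of_var_ne_zero _ hv, gaussianReal_of_var_ne_zero _ hv,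
    ← withDensity_mul _ (measurable_gaussianPDF _ _) (by fun_prop)]
  congr 1
  ext x
  simp only [Pi.mul_apply, gaussianPDF]
  rw [← ENNReal.ofReal_mul (gaussianPDFReal_nonneg _ _ _)]
  congr 1
  simp only [gaussianPDFReal, NNReal.coe_inv, NNReal.coe_natCast]
  rw [mul_assoc (_)⁻¹ (Real.exp _), ← Real.exp_add]
  congr 2
  field_simp
  ring

/-- `likelihood` is indeed the density of `P_θ^{(n)}` with respect to `P_0^{(n)}`. -/
theorem law_eq_withDensity_likelihood (n : ℕ) (hn : 1 ≤ n) (k : ℕ) (θ : ℕ → ℝ)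
    (hθ : ∀ i, k ≤ i → θ i = 0) :
    law n θ = (law n 0).withDensity (likelihood n (k, θ)) := by
  classical
  symm
  apply Measure.eq_infinitePi
  intro s t ht
  set h : ℕ → ℝ → ℝ≥0∞ := fun i x =>
    ENNReal.ofReal (Real.exp ((n : ℝ) * (θ i * x - θ i ^ 2 / 2))) with hh
  set S : Finset ℕ := s ∪ Finset.range k
  have hm : ∀ i, Measurable (h i) := fun i => by fun_prop
  have h1 : ∀ i, k ≤ i → ∀ x, h i x = 1 := fun i hi x => by simp [hh, hθ i hi]
  set F : ℕ → ℝ → ℝ≥0∞ := fun i x =>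
    (if i ∈ s then (t i).indicator 1 x else 1) * h i x
  have hF : ∀ i, Measurable (F i) := fun i => by
    refine Measurable.mul ?_ (hm i)
    split_ifs
    · exact measurable_one.indicator (ht i)
    · exact measurable_const
  have hL : ∀ x, likelihood n (k, θ) x = ∏ i ∈ S, h i (x i) := fun x => by
    have : ∏ i ∈ S, h i (x i) = ∏ i ∈ Finset.range k, h i (x i) := by
      symm
      apply Finset.prod_subset Finset.subset_union_right
      intro i _ hi
      exact h1 i (by simpa using hi) _
    rw [this]
    simp only [likelihood, hh, Real.exp_sum]
    rw [ENNReal.ofReal_prod_of_nonneg (fun _ _ => (Real.exp_pos _).le)]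
  have hI : ∀ x : ℕ → ℝ, (Set.pi (s : Set ℕ) t).indicator (likelihood n (k, θ)) x
      = ∏ i ∈ S, F i (x i) := fun x => by
    simp only [F, Finset.prod_mul_distrib, ← hL]
    have : ∏ i ∈ S, (if i ∈ s then (t i).indicator (1 : ℝ → ℝ≥0∞) (x i) else 1)
        = ∏ i ∈ s, (t i).indicator (1 : ℝ → ℝ≥0∞) (x i) := by
      rw [Finset.prod_ite_mem]
      congr 1
      ext i
      simp only [S, Finset.mem_inter, Finset.mem_union]
      tauto
    rw [this]
    by_cases hx : x ∈ Set.pi (s : Set ℕ) t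
    · rw [Set.indicator_of_mem hx, Finset.prod_eq_one, one_mul]
      intro i hi
      simp [hx i hi]
    · rw [Set.indicator_of_notMem hx]
      simp only [Set.mem_pi, not_forall] at hx
      obtain ⟨i, hi, hxi⟩ := hx
      rw [Finset.prod_eq_zero hi (by simp [hxi]), zero_mul]
  have hpi : MeasurableSet (Set.pi (s : Set ℕ) t) :=
    MeasurableSet.pi s.countable_toSet fun i _ => ht i
  rw [withDensity_apply _ hpi, ← lintegral_indicator hpi]
  simp_rw [hI]
  have hind : iIndepFun (fun i (x : ℕ → ℝ) => F i (x i)) (law n 0) :=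
    iIndepFun_infinitePi (P := fun i => gaussianReal ((0 : ℕ → ℝ) i) ((n : ℝ≥0)⁻¹)) hF
  rw [lintegral_prod_eq_prod_lintegral_of_indepFun S _ hind
    (fun i => (hF i).comp (measurable_pi_apply i))]
  have hmarg : ∀ i, ∫⁻ x, F i (x i) ∂(law n 0)
      = if i ∈ s then gaussianReal (θ i) ((n : ℝ≥0)⁻¹) (t i) else 1 := fun i => by
    have e : (law n 0).map (fun x => x i) = gaussianReal 0 ((n : ℝ≥0)⁻¹) :=
      Measure.infinitePi_map_eval _ i
    rw [← lintegral_map (hF i) (measurable_pi_apply i), e]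
    split_ifs with hi
    · rw [gaussianReal_eq_withDensity n hn (θ i), withDensity_apply _ (ht i),
        ← lintegral_indicator (ht i)]
      congr 1
      ext x
      simp only [F, hi, if_true, hh]
      by_cases hx : x ∈ t i <;> simp [hx]
    · have : (gaussianReal (θ i) ((n : ℝ≥0)⁻¹)) Set.univ = 1 := measure_univ
      rw [← this, gaussianReal_eq_withDensity n hn (θ i), withDensity_apply _ .univ]
      simp [F, hi, hh]
  simp_rw [hmarg]
  rw [Finset.prod_ite_mem]
  congr 1
  ext i
  simp only [S, Finset.mem_inter, Finset.mem_union]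
  tauto

end GaussianSequence

end

/-! ### One-dimensional estimates for a standardized observation. -/

noncomputable section

namespace GaussianSequence

/-! Write `m = n^{1/(2α+1)} = n ε_n²` and `J = ⌊m⌋`. After scaling by `√n` the coordinates are
independent `N(μ_i, 1)` with `μ_i = √n θ₀_i`, and the marginal likelihood of dimension `k` is a
product of one-dimensional evidences. No testing argument is needed: the posterior mass is split
over `k`, and each slice is bounded by a product whose expectation factorizes.

Three bounds on a slice suffice. For `k ≥ J`, compare with dimension `J`. The slice is at most one,
hence at most the square root of the evidence ratio. Cauchy–Schwarz bounds its mean by `exp(∑ μ_i² /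
2)` over the extra coordinates, where the Sobolev condition gives `∑ μ_i² ≤ Q² m`. The remaining
factor `√(π k / π J)` decays geometrically, so dimensions beyond `dimConst * m` are negligible
(`tsum_tail_le`).

For `k ≤ J`, the inverse evidences of the omitted coordinates have means at most `exp(b - μ_i²/6)`,
with `b = evidenceExponent C`, so a dimension that omits much signal has small mass. For any `k`,
Markov's inequality for `exp(n ‖θ - θ₀‖² / 8)` on the first `k` coordinates costs `exp(k b)`.

If `θ` is far from `θ₀` and `k ≤ dimConst * m`, either the omitted signal or the error on the first
`k` coordinates is large, so one of the last two bounds applies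
(`lintegral_posteriorSlice_sqDist_le`). -/

theorem lintegral_exp_neg_mul_sub_sq {b : ℝ} (hb : 0 < b) (v : ℝ) :
    ∫⁻ u : ℝ, ENNReal.ofReal (Real.exp (-b * (u - v) ^ 2)) = ENNReal.ofReal √(Real.pi / b) := by
  rw [lintegral_sub_right_eq_self (fun u : ℝ => ENNReal.ofReal (Real.exp (-b * u ^ 2))) v,
    ← ofReal_integral_eq_lintegral_ofReal (integrable_exp_neg_mul_sq hb)
      (Filter.Eventually.of_forall fun _ => (Real.exp_pos _).le), integral_gaussian]

/-- The condition on the prior density: its logarithm is Lipschitz at large scales. -/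
structure IsLogLipschitz (C : ℝ) (g : ℝ → ℝ) : Prop where
  density : IsPosDensity g
  abs_log_sub : ∀ x y : ℝ, |Real.log (g x) - Real.log (g y)| ≤ C * (1 + |x - y|)
  abs_log_zero : |Real.log (g 0)| ≤ C

/-- The marginal likelihood of a standardized observation `y`, when its mean has density `g`. -/
def evidence (g : ℝ → ℝ) (y : ℝ) : ℝ≥0∞ :=
  ∫⁻ t, ENNReal.ofReal (Real.exp (t * y - t ^ 2 / 2)) * ENNReal.ofReal (g t)

/-- The unnormalized posterior exponential moment of the squared distance to `μ`. -/
def expMoment (g : ℝ → ℝ) (μ y : ℝ) : ℝ≥0∞ :=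
  ∫⁻ t, ENNReal.ofReal (Real.exp ((t - μ) ^ 2 / 8)) *
    (ENNReal.ofReal (Real.exp (t * y - t ^ 2 / 2)) * ENNReal.ofReal (g t))

theorem measurable_evidence {g : ℝ → ℝ} (hg : Measurable g) : Measurable (evidence g) := by
  unfold evidence
  refine Measurable.lintegral_prod_right' (f := fun p : ℝ × ℝ =>
    ENNReal.ofReal (Real.exp (p.2 * p.1 - p.2 ^ 2 / 2)) * ENNReal.ofReal (g p.2)) ?_
  fun_prop

theorem measurable_expMoment {g : ℝ → ℝ} (hg : Measurable g) (μ : ℝ) :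
    Measurable (expMoment g μ) := by
  unfold expMoment
  refine Measurable.lintegral_prod_right' (f := fun p : ℝ × ℝ =>
    ENNReal.ofReal (Real.exp ((p.2 - μ) ^ 2 / 8)) *
    (ENNReal.ofReal (Real.exp (p.2 * p.1 - p.2 ^ 2 / 2)) * ENNReal.ofReal (g p.2))) ?_
  fun_prop

namespace IsLogLipschitz

variable {C : ℝ} {g : ℝ → ℝ}

theorem le_mul_exp (h : IsLogLipschitz C g) (x y : ℝ) :
    g x ≤ g y * Real.exp (C * (1 + |x - y|)) := by
  rw [← Real.exp_log (h.density.pos x), ← Real.exp_log (h.density.pos y), ← Real.exp_add]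
  exact Real.exp_le_exp.2 (by linarith [(abs_le.1 (h.abs_log_sub x y)).2])

theorem exp_le (h : IsLogLipschitz C g) (y : ℝ) : Real.exp (-(2 * C) - C * |y|) ≤ g y := by
  rw [← Real.exp_log (h.density.pos y)]
  have h1 := (abs_le.1 (h.abs_log_sub y 0)).1
  have h2 := (abs_le.1 h.abs_log_zero).1
  rw [sub_zero] at h1
  exact Real.exp_le_exp.2 (by linarith)

/-- Here `exp(ty - t²/2) = exp(y²/2 - (t-y)²/2)`, and replacing `g t` by `g y` costs `C(1 + |t-y|) ≤
C + C²/2 + (t-y)²/2`. What remains is the integral of `exp(-(t-y)²)`. -/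
theorem le_evidence (h : IsLogLipschitz C g) (y : ℝ) :
    ENNReal.ofReal (√Real.pi * (Real.exp (y ^ 2 / 2 - C - C ^ 2 / 2) * g y)) ≤ evidence g y := by
  have h0 := lintegral_exp_neg_mul_sub_sq one_pos y
  rw [div_one] at h0
  rw [ENNReal.ofReal_mul (by positivity), ← h0, ← lintegral_mul_const' _ _ ENNReal.ofReal_ne_top]
  refine lintegral_mono fun t => ?_
  rw [← ENNReal.ofReal_mul (by positivity), ← ENNReal.ofReal_mul (by positivity)]
  refine ENNReal.ofReal_le_ofReal ?_
  have h1 : g y * Real.exp (-(C * (1 + |y - t|))) ≤ g t := by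
    rw [Real.exp_neg, ← div_eq_mul_inv, div_le_iff₀ (Real.exp_pos _)]
    exact h.le_mul_exp y t
  refine le_trans ?_ (mul_le_mul_of_nonneg_left h1 (Real.exp_pos _).le)
  rw [← mul_assoc, ← Real.exp_add, mul_left_comm, ← Real.exp_add, mul_comm (g y)]
  refine mul_le_mul_of_nonneg_right (Real.exp_le_exp.2 ?_) (h.density.pos y).le
  have h2 := sq_nonneg (|y - t| - C)
  have h3 := sq_abs (y - t)
  nlinarith

/-- The quadratic budget in `(t-y)²` is `-1/2 + 1/4 + 1/8 = -1/8`: the `1/4` comes from `(t-μ)²/8 ≤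
(t-y)²/4 + (y-μ)²/4`, the last `1/8` from the log-Lipschitz error. -/
theorem expMoment_le (h : IsLogLipschitz C g) (μ y : ℝ) :
    expMoment g μ y ≤ ENNReal.ofReal (√(8 * Real.pi) *
      (Real.exp (y ^ 2 / 2 + (y - μ) ^ 2 / 4 + C + 2 * C ^ 2) * g y)) := by
  have h0 := lintegral_exp_neg_mul_sub_sq (b := 1 / 8) (by norm_num) y
  rw [show Real.pi / (1 / 8) = 8 * Real.pi by ring] at h0
  rw [ENNReal.ofReal_mul (by positivity), ← h0, ← lintegral_mul_const' _ _ ENNReal.ofReal_ne_top]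
  refine lintegral_mono fun t => ?_
  rw [← ENNReal.ofReal_mul (by positivity), ← ENNReal.ofReal_mul (by positivity),
    ← ENNReal.ofReal_mul (by positivity)]
  refine ENNReal.ofReal_le_ofReal ?_
  rw [← mul_assoc, ← Real.exp_add]
  refine (mul_le_mul_of_nonneg_left (h.le_mul_exp t y) (Real.exp_pos _).le).trans ?_
  rw [mul_left_comm, ← Real.exp_add, ← mul_assoc, ← Real.exp_add, mul_comm]
  refine mul_le_mul_of_nonneg_right (Real.exp_le_exp.2 ?_) (h.density.pos y).le
  have h2 := sq_nonneg (|t - y| - 4 * C)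
  have h3 := sq_abs (t - y)
  have h4 := sq_nonneg (t - y - (y - μ))
  nlinarith

theorem evidence_ne_zero (h : IsLogLipschitz C g) (y : ℝ) : evidence g y ≠ 0 := by
  have := h.density.pos y
  refine (lt_of_lt_of_le (ENNReal.ofReal_pos.2 ?_) (h.le_evidence y)).ne'
  positivity

theorem evidence_ne_top (h : IsLogLipschitz C g) (y : ℝ) : evidence g y ≠ ∞ := by
  refine ne_top_of_le_ne_top ENNReal.ofReal_ne_top (le_trans ?_ (h.expMoment_le y y))
  refine lintegral_mono fun t => le_mul_of_one_le_left zero_le ?_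
  rw [ENNReal.one_le_ofReal]
  exact Real.one_le_exp (by positivity)

/-- The prior tail costs only `C|y| ≤ y²/4 + C²`, which leaves half of the Gaussian gain `y²/2`. -/
theorem evidence_inv_le (h : IsLogLipschitz C g) (y : ℝ) :
    (evidence g y)⁻¹ ≤ ENNReal.ofReal (Real.exp (3 * C + 3 / 2 * C ^ 2)) *
      ENNReal.ofReal (Real.exp (-(y ^ 2 / 4))) := by
  rw [← ENNReal.ofReal_mul (Real.exp_pos _).le, ← Real.exp_add,
    ENNReal.inv_le_iff_inv_le, ← ENNReal.ofReal_inv_of_pos (Real.exp_pos _), ← Real.exp_neg]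
  refine le_trans (ENNReal.ofReal_le_ofReal ?_) (h.le_evidence y)
  have h1 : 1 ≤ √Real.pi := Real.one_le_sqrt.2 (by linarith [Real.pi_gt_three])
  refine le_trans ?_ (le_mul_of_one_le_left (by have := h.density.pos y; positivity) h1)
  refine le_trans ?_ (mul_le_mul_of_nonneg_left (h.exp_le y) (Real.exp_pos _).le)
  rw [← Real.exp_add]
  refine Real.exp_le_exp.2 ?_
  have h2 := sq_nonneg (|y| - 2 * C)
  have h3 := sq_abs y
  nlinarith

/-- Both bounds carry the factor `exp(y²/2) * g y`, which cancels. The result no longer depends on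
the size of `μ`, and `(y-μ)²/4` still has a finite exponential moment under `N(μ, 1)`. -/
theorem expMoment_div_evidence_le (h : IsLogLipschitz C g) (μ y : ℝ) :
    expMoment g μ y / evidence g y ≤ ENNReal.ofReal (√8 * Real.exp (2 * C + 5 / 2 * C ^ 2)) *
      ENNReal.ofReal (Real.exp ((y - μ) ^ 2 / 4)) := by
  refine ENNReal.div_le_of_le_mul ((h.expMoment_le μ y).trans ?_)
  refine le_trans ?_ (mul_le_mul_right (h.le_evidence y) _)
  rw [← ENNReal.ofReal_mul (by positivity), ← ENNReal.ofReal_mul (by positivity)]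
  refine ENNReal.ofReal_le_ofReal (le_of_eq ?_)
  rw [Real.sqrt_mul (by norm_num)]
  have : Real.exp (y ^ 2 / 2 + (y - μ) ^ 2 / 4 + C + 2 * C ^ 2) =
      Real.exp (2 * C + 5 / 2 * C ^ 2) * Real.exp ((y - μ) ^ 2 / 4) *
        Real.exp (y ^ 2 / 2 - C - C ^ 2 / 2) := by
    rw [← Real.exp_add, ← Real.exp_add]
    congr 1
    ring
  rw [this]
  ring

end IsLogLipschitz

/-- The completed square is supplied as `h`, so that each application reduces to a `ring` identity.
-/
theorem lintegral_exp_gaussianReal {μ b v d : ℝ} (hb : 0 < b) {q : ℝ → ℝ} (hq : Measurable q)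
    (h : ∀ y, q y - (y - μ) ^ 2 / 2 = -b * (y - v) ^ 2 + d) :
    ∫⁻ y, ENNReal.ofReal (Real.exp (q y)) ∂gaussianReal μ 1 =
      ENNReal.ofReal (√(1 / (2 * b)) * Real.exp d) := by
  rw [gaussianReal_of_var_ne_zero _ one_ne_zero,
    lintegral_withDensity_eq_lintegral_mul _ (measurable_gaussianPDF _ _) (by fun_prop)]
  have h1 : ∀ y, (gaussianPDF μ 1 * fun y => ENNReal.ofReal (Real.exp (q y))) y =
      ENNReal.ofReal ((√(2 * Real.pi))⁻¹ * Real.exp d) *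
        ENNReal.ofReal (Real.exp (-b * (y - v) ^ 2)) := fun y => by
    rw [Pi.mul_apply, gaussianPDF, gaussianPDFReal, ← ENNReal.ofReal_mul (by positivity),
      ← ENNReal.ofReal_mul (by positivity), NNReal.coe_one, mul_one, mul_one,
      mul_assoc (√(2 * Real.pi))⁻¹, mul_assoc (√(2 * Real.pi))⁻¹, ← Real.exp_add, ← Real.exp_add]
    congr 3
    linarith [h y]
  simp_rw [h1]
  rw [lintegral_const_mul' _ _ ENNReal.ofReal_ne_top, lintegral_exp_neg_mul_sub_sq hb,
    ← ENNReal.ofReal_mul (by positivity)]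
  congr 1
  rw [mul_right_comm]
  congr 1
  rw [← Real.sqrt_inv, ← Real.sqrt_mul (by positivity)]
  congr 1
  field_simp

theorem gaussianReal_one_eq_withDensity (m : ℝ) :
    gaussianReal m 1 = (gaussianReal 0 1).withDensity
      (fun x => ENNReal.ofReal (Real.exp (m * x - m ^ 2 / 2))) := by
  simpa using gaussianReal_eq_withDensity 1 le_rfl m

/-- By Tonelli: `exp(ty - t²/2)` is the density of `N(t, 1)` relative to `N(0, 1)` and so has mass
one for every `t`. -/
theorem lintegral_evidence_gaussianReal_zero {g : ℝ → ℝ} (hg : IsPosDensity g) :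
    ∫⁻ y, evidence g y ∂gaussianReal 0 1 = 1 := by
  have hm := hg.measurable
  unfold evidence
  rw [lintegral_lintegral_swap (by fun_prop)]
  have h1 : ∀ t : ℝ, ∫⁻ y, ENNReal.ofReal (Real.exp (t * y - t ^ 2 / 2)) *
      ENNReal.ofReal (g t) ∂gaussianReal 0 1 = ENNReal.ofReal (g t) := fun t => by
    rw [lintegral_mul_const' _ _ ENNReal.ofReal_ne_top,
      lintegral_exp_gaussianReal (b := 1 / 2) (v := t) (d := 0) (by norm_num) (by fun_prop)
        (fun y => by ring)]
    norm_num
  simp_rw [h1]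
  exact hg.lintegral_eq_one

/-- Change the measure to `N(0, 1)` and apply Cauchy–Schwarz: the squared root of the evidence
integrates to one, and the likelihood ratio has second moment `exp(μ²)`. -/
theorem lintegral_sqrt_evidence_le {g : ℝ → ℝ} (hg : IsPosDensity g) (μ : ℝ) :
    ∫⁻ y, evidence g y ^ (1 / 2 : ℝ) ∂gaussianReal μ 1 ≤
      ENNReal.ofReal (Real.exp (μ ^ 2 / 2)) := by
  have hm := measurable_evidence hg.measurable
  rw [gaussianReal_one_eq_withDensity,
    lintegral_withDensity_eq_lintegral_mul _ (by fun_prop) (by fun_prop)]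
  refine (ENNReal.lintegral_mul_le_Lp_mul_Lq (gaussianReal 0 1) Real.HolderConjugate.two_two
    (by fun_prop) (by fun_prop)).trans ?_
  have h1 : ∀ y : ℝ, ENNReal.ofReal (Real.exp (μ * y - μ ^ 2 / 2)) ^ (2 : ℝ) =
      ENNReal.ofReal (Real.exp (2 * (μ * y - μ ^ 2 / 2))) := fun y => by
    rw [ENNReal.ofReal_rpow_of_pos (Real.exp_pos _), ← Real.exp_mul, mul_comm]
  have h2 : ∀ y : ℝ, (evidence g y ^ (1 / 2 : ℝ)) ^ (2 : ℝ) = evidence g y := fun y => by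
    rw [← ENNReal.rpow_mul]; norm_num
  simp_rw [h1, h2]
  rw [lintegral_evidence_gaussianReal_zero hg, ENNReal.one_rpow, mul_one,
    lintegral_exp_gaussianReal (b := 1 / 2) (v := 2 * μ) (d := μ ^ 2) (by norm_num) (by fun_prop)
      (fun y => by ring)]
  norm_num
  rw [ENNReal.ofReal_rpow_of_pos (Real.exp_pos _), ← Real.exp_mul]
  exact ENNReal.ofReal_le_ofReal (Real.exp_le_exp.2 (by linarith))

/-- The exponent controlling the one-dimensional evidence bounds. -/
def evidenceExponent (C : ℝ) : ℝ := 2 + 3 * C + 3 * C ^ 2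

/-- The term `-μ²/6` is the penalty for omitting a coordinate with signal `μ`; it arises as the mean
of `exp(-y²/4)` under `N(μ, 1)`. -/
theorem IsLogLipschitz.lintegral_evidence_inv_le {C : ℝ} {g : ℝ → ℝ} (h : IsLogLipschitz C g)
    (μ : ℝ) : ∫⁻ y, (evidence g y)⁻¹ ∂gaussianReal μ 1 ≤
      ENNReal.ofReal (Real.exp (evidenceExponent C - μ ^ 2 / 6)) := by
  refine (lintegral_mono h.evidence_inv_le).trans ?_
  rw [lintegral_const_mul' _ _ ENNReal.ofReal_ne_top,
    lintegral_exp_gaussianReal (b := 3 / 4) (v := 2 / 3 * μ) (d := -(μ ^ 2 / 6)) (by norm_num)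
      (by fun_prop) (fun y => by ring), ← ENNReal.ofReal_mul (Real.exp_pos _).le]
  refine ENNReal.ofReal_le_ofReal ?_
  have h1 : √(1 / (2 * (3 / 4)) : ℝ) ≤ 1 := Real.sqrt_le_one.2 (by norm_num)
  refine (mul_le_mul_of_nonneg_left (mul_le_of_le_one_left (Real.exp_pos _).le h1)
    (Real.exp_pos _).le).trans ?_
  rw [← Real.exp_add, evidenceExponent]
  exact Real.exp_le_exp.2 (by nlinarith [sq_nonneg C])

theorem IsLogLipschitz.lintegral_expMoment_div_evidence_le {C : ℝ} {g : ℝ → ℝ}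
    (hC : 0 ≤ C) (h : IsLogLipschitz C g) (μ : ℝ) :
    ∫⁻ y, expMoment g μ y / evidence g y ∂gaussianReal μ 1 ≤
      ENNReal.ofReal (Real.exp (evidenceExponent C)) := by
  refine (lintegral_mono (h.expMoment_div_evidence_le μ)).trans ?_
  rw [lintegral_const_mul' _ _ ENNReal.ofReal_ne_top,
    lintegral_exp_gaussianReal (b := 1 / 4) (v := μ) (d := 0) (by norm_num)
      (by fun_prop) (fun y => by ring), ← ENNReal.ofReal_mul (by positivity)]
  refine ENNReal.ofReal_le_ofReal ?_
  have h1 : √8 * √(1 / (2 * (1 / 4)) : ℝ) = 4 := by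
    rw [← Real.sqrt_mul (by norm_num), show (8 * (1 / (2 * (1 / 4))) : ℝ) = 4 ^ 2 by norm_num,
      Real.sqrt_sq (by norm_num)]
  -- This absorbs the prefactor `√8 * √2 = 4` into the summand `2` of `evidenceExponent`.
  have h2 : (4 : ℝ) ≤ Real.exp 2 := by
    have := Real.add_one_le_exp 1
    rw [show (2 : ℝ) = 1 + 1 by norm_num, Real.exp_add]
    nlinarith
  calc _ = 4 * Real.exp (2 * C + 5 / 2 * C ^ 2) := by
        rw [Real.exp_zero, mul_one, mul_right_comm, h1]
    _ ≤ Real.exp 2 * Real.exp (2 * C + 5 / 2 * C ^ 2) := by gcongr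
    _ ≤ _ := by
        rw [← Real.exp_add, evidenceExponent]
        exact Real.exp_le_exp.2 (by nlinarith [sq_nonneg C])

end GaussianSequence
end

/-! ### Factorization over coordinates and pointwise bounds on posterior slices. -/

noncomputable section

namespace GaussianSequence

theorem lintegral_coordPrior (n : ℕ) {g : ℝ → ℝ} (hg : Measurable g) {f : ℝ → ℝ≥0∞}
    (hf : Measurable f) :
    ∫⁻ θ, f θ ∂coordPrior n g = ∫⁻ t, f (t / √(n : ℝ)) * ENNReal.ofReal (g t) := by
  rw [coordPrior, lintegral_map hf (by fun_prop),
    lintegral_withDensity_eq_lintegral_mul _ (by fun_prop) (by fun_prop)]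
  simp_rw [Pi.mul_apply, mul_comm]

theorem isProbabilityMeasure_coordPrior (n : ℕ) {g : ℝ → ℝ} (hg : IsPosDensity g) :
    IsProbabilityMeasure (coordPrior n g) := by
  constructor
  rw [← lintegral_one, lintegral_coordPrior n hg.measurable measurable_const]
  simp [hg.lintegral_eq_one]

theorem measurable_extendZero (k : ℕ) : Measurable (extendZero k) := by
  refine measurable_pi_iff.2 fun i => ?_
  unfold extendZero
  split_ifs with h
  · exact measurable_pi_apply _
  · exact measurable_const

theorem measurable_likelihood (n : ℕ) (x : ℕ → ℝ) : Measurable fun p => likelihood n p x := by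
  refine measurable_from_prod_countable_right fun k => ?_
  exact (Real.measurable_exp.comp (Finset.measurable_sum (Finset.range k) fun i _ =>
    by fun_prop)).ennreal_ofReal

theorem lintegral_prod_condPrior (n k : ℕ) {g : ℝ → ℝ} (hg : IsPosDensity g)
    {φ : ℕ → ℝ → ℝ≥0∞} (hφ : ∀ i, Measurable (φ i)) :
    ∫⁻ θ, ∏ i ∈ Finset.range k, φ i (θ i) ∂condPrior n g k =
      ∏ i ∈ Finset.range k, ∫⁻ t, φ i (t / √(n : ℝ)) * ENNReal.ofReal (g t) := by
  have := isProbabilityMeasure_coordPrior n hg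
  rw [condPrior, lintegral_map (by fun_prop) (measurable_extendZero k)]
  have h1 : ∀ t : Fin k → ℝ, ∏ i ∈ Finset.range k, φ i (extendZero k t i) =
      ∏ i : Fin k, φ i (t i) := fun t => by
    rw [Finset.prod_range]
    simp [extendZero]
  simp_rw [h1]
  rw [lintegral_prod_eq_prod_lintegral_of_indepFun Finset.univ
    (fun (i : Fin k) (t : Fin k → ℝ) => φ i (t i))
    (iIndepFun_pi (X := fun i : Fin k => φ i) fun i => (hφ i).aemeasurable)
    (fun i => (hφ i).comp (measurable_pi_apply i)), Finset.prod_range]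
  refine Finset.prod_congr rfl fun i _ => ?_
  rw [← lintegral_coordPrior n hg.measurable (hφ i)]
  exact (measurePreserving_eval (fun _ : Fin k => coordPrior n g) i).lintegral_comp (hφ i)

/-- The marginal likelihood of the observation `x` in dimension `k`. -/
def marginal (n : ℕ) (g : ℝ → ℝ) (k : ℕ) (x : ℕ → ℝ) : ℝ≥0∞ :=
  ∏ i ∈ Finset.range k, evidence g (√(n : ℝ) * x i)

/-- The likelihood of `x`, integrated over the part of `A` in dimension `k`. -/
def sliceMass (n : ℕ) (g : ℝ → ℝ) (A : Set (ℕ × (ℕ → ℝ))) (k : ℕ) (x : ℕ → ℝ) : ℝ≥0∞ :=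
  ∫⁻ θ, A.indicator (fun p => likelihood n p x) (k, θ) ∂condPrior n g k

theorem setLIntegral_sievePrior (n : ℕ) (π : PMF ℕ) (g : ℝ → ℝ) {A : Set (ℕ × (ℕ → ℝ))}
    (hA : MeasurableSet A) (x : ℕ → ℝ) :
    ∫⁻ p in A, likelihood n p x ∂sievePrior n π g = ∑' k, π k * sliceMass n g A k x := by
  rw [← lintegral_indicator hA, sievePrior, lintegral_sum_measure]
  refine tsum_congr fun k => ?_
  rw [lintegral_smul_measure, lintegral_map ((measurable_likelihood n x).indicator hA)
    (by fun_prop), smul_eq_mul, sliceMass]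

theorem likelihood_eq_prod (n k : ℕ) (θ x : ℕ → ℝ) :
    likelihood n (k, θ) x = ∏ i ∈ Finset.range k,
      ENNReal.ofReal (Real.exp ((n : ℝ) * (θ i * x i - θ i ^ 2 / 2))) := by
  rw [likelihood, Real.exp_sum, ENNReal.ofReal_prod_of_nonneg fun _ _ => (Real.exp_pos _).le]

theorem scaled_exponent {n : ℕ} (hn : 1 ≤ n) (t x : ℝ) :
    (n : ℝ) * (t / √(n : ℝ) * x - (t / √(n : ℝ)) ^ 2 / 2) = t * (√(n : ℝ) * x) - t ^ 2 / 2 := by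
  have h0 : (0 : ℝ) < √(n : ℝ) := Real.sqrt_pos.2 (by exact_mod_cast hn)
  have h1 : (n : ℝ) = √(n : ℝ) ^ 2 := (Real.sq_sqrt (Nat.cast_nonneg n)).symm
  nth_rewrite 1 [h1]
  field_simp

theorem sliceMass_univ {n : ℕ} (hn : 1 ≤ n) {g : ℝ → ℝ} (hg : IsPosDensity g) (k : ℕ)
    (x : ℕ → ℝ) : sliceMass n g Set.univ k x = marginal n g k x := by
  simp only [sliceMass, Set.indicator_univ, likelihood_eq_prod]
  rw [lintegral_prod_condPrior n k hg (φ := fun i θ =>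
    ENNReal.ofReal (Real.exp ((n : ℝ) * (θ * x i - θ ^ 2 / 2)))) (fun i => by fun_prop)]
  simp_rw [scaled_exponent hn, marginal, evidence]

theorem sliceMass_le_marginal {n : ℕ} (hn : 1 ≤ n) {g : ℝ → ℝ} (hg : IsPosDensity g)
    (A : Set (ℕ × (ℕ → ℝ))) (k : ℕ) (x : ℕ → ℝ) : sliceMass n g A k x ≤ marginal n g k x := by
  rw [← sliceMass_univ hn hg]
  exact lintegral_mono fun θ => Set.indicator_le_indicator_of_subset (Set.subset_univ A)
    (fun _ => zero_le) _

/-- The part in dimension `k` of the posterior mass of `A`. -/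
def posteriorSlice (n : ℕ) (π : PMF ℕ) (g : ℝ → ℝ) (A : Set (ℕ × (ℕ → ℝ))) (k : ℕ)
    (x : ℕ → ℝ) : ℝ≥0∞ :=
  π k * sliceMass n g A k x / ∑' j, π j * marginal n g j x

theorem posterior_eq_tsum {n : ℕ} (hn : 1 ≤ n) (π : PMF ℕ) {g : ℝ → ℝ} (hg : IsPosDensity g)
    {A : Set (ℕ × (ℕ → ℝ))} (hA : MeasurableSet A) (x : ℕ → ℝ) :
    posterior n π g A x = ∑' k, posteriorSlice n π g A k x := by
  have h := setLIntegral_sievePrior n π g MeasurableSet.univ x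
  rw [setLIntegral_univ] at h
  simp_rw [sliceMass_univ hn hg] at h
  rw [posterior, setLIntegral_sievePrior n π g hA, h]
  simp_rw [posteriorSlice, div_eq_mul_inv, ENNReal.tsum_mul_right]

variable {n : ℕ} {π : PMF ℕ} {g : ℝ → ℝ} {C : ℝ}

theorem posteriorSlice_le_one (hn : 1 ≤ n) (hg : IsPosDensity g)
    (A : Set (ℕ × (ℕ → ℝ))) (k : ℕ) (x : ℕ → ℝ) : posteriorSlice n π g A k x ≤ 1 := by
  refine ENNReal.div_le_of_le_mul ?_
  rw [one_mul]
  exact (mul_le_mul_right (sliceMass_le_marginal hn hg A k x) _).trans (ENNReal.le_tsum k)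

theorem posteriorSlice_le_div (hn : 1 ≤ n) (hg : IsPosDensity g)
    (A : Set (ℕ × (ℕ → ℝ))) (k J : ℕ) (x : ℕ → ℝ) :
    posteriorSlice n π g A k x ≤ π k * marginal n g k x / (π J * marginal n g J x) :=
  ENNReal.div_le_div (mul_le_mul_right (sliceMass_le_marginal hn hg A k x) _) (ENNReal.le_tsum J)

theorem IsLogLipschitz.marginal_ne_zero (h : IsLogLipschitz C g) (k : ℕ) (x : ℕ → ℝ) :
    marginal n g k x ≠ 0 :=
  Finset.prod_ne_zero_iff.2 fun _ _ => h.evidence_ne_zero _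

theorem IsLogLipschitz.marginal_ne_top (h : IsLogLipschitz C g) (k : ℕ) (x : ℕ → ℝ) :
    marginal n g k x ≠ ∞ :=
  ENNReal.prod_ne_top fun _ _ => h.evidence_ne_top _

/-- Keeping only the `k`-th term of the denominator leaves the conditional posterior given `k`, in
which `π` no longer appears. -/
theorem posteriorSlice_le_sliceMass_div (A : Set (ℕ × (ℕ → ℝ))) (k : ℕ) (x : ℕ → ℝ) :
    posteriorSlice n π g A k x ≤ sliceMass n g A k x / marginal n g k x := by
  rcases eq_or_ne (π k) 0 with h0 | h0
  · simp [posteriorSlice, h0]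
  · refine (ENNReal.div_le_div le_rfl (ENNReal.le_tsum k)).trans ?_
    rw [ENNReal.mul_div_mul_left _ _ h0 (π.apply_ne_top k)]

theorem marginal_mul_prod_Ico {k l : ℕ} (hkl : k ≤ l) (x : ℕ → ℝ) :
    marginal n g k x * ∏ i ∈ Finset.Ico k l, evidence g (√(n : ℝ) * x i) = marginal n g l x :=
  Finset.prod_range_mul_prod_Ico _ hkl

/-- Keep only the `J`-th term of the denominator; the evidences of the common coordinates cancel. -/
theorem posteriorSlice_le_of_le (hn : 1 ≤ n) (h : IsLogLipschitz C g)
    (A : Set (ℕ × (ℕ → ℝ))) {k J : ℕ} (hkJ : k ≤ J) (x : ℕ → ℝ) :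
    posteriorSlice n π g A k x ≤
      (π J)⁻¹ * ∏ i ∈ Finset.Ico k J, (evidence g (√(n : ℝ) * x i))⁻¹ := by
  refine (posteriorSlice_le_div hn h.density A k J x).trans ?_
  rw [← marginal_mul_prod_Ico hkJ, mul_left_comm, mul_comm (π k),
    ENNReal.mul_div_mul_left _ _ (h.marginal_ne_zero k x) (h.marginal_ne_top k x),
    div_eq_mul_inv, ENNReal.mul_inv (Or.inr (ENNReal.prod_ne_top fun _ _ => h.evidence_ne_top _))
      (Or.inl (π.apply_ne_top J)), ENNReal.prod_inv_distrib]
  · exact mul_le_of_le_one_left zero_le (π.coe_le_one k)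
  · intro i _ j _ _
    exact Or.inl (h.evidence_ne_zero _)

/-- A number in `[0, 1]` is at most its square root. The root is taken because the evidence itself
need not have a finite mean under `N(μ, 1)`. -/
theorem posteriorSlice_le_of_ge (hn : 1 ≤ n) (h : IsLogLipschitz C g)
    (A : Set (ℕ × (ℕ → ℝ))) {k J : ℕ} (hkJ : J ≤ k) (x : ℕ → ℝ) :
    posteriorSlice n π g A k x ≤
      (π k / π J) ^ (1 / 2 : ℝ) *
        ∏ i ∈ Finset.Ico J k, evidence g (√(n : ℝ) * x i) ^ (1 / 2 : ℝ) := by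
  have h1 := posteriorSlice_le_div (π := π) hn h.density A k J x
  rw [← marginal_mul_prod_Ico hkJ, mul_left_comm, mul_comm (π J),
    ENNReal.mul_div_mul_left _ _ (h.marginal_ne_zero J x) (h.marginal_ne_top J x),
    ENNReal.mul_div_right_comm] at h1
  have h2 := ENNReal.rpow_le_rpow_of_exponent_ge
    (posteriorSlice_le_one (π := π) hn h.density A k x) (show (1 / 2 : ℝ) ≤ 1 by norm_num)
  rw [ENNReal.rpow_one] at h2
  refine h2.trans ((ENNReal.rpow_le_rpow h1 (by norm_num)).trans (le_of_eq ?_))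
  rw [ENNReal.mul_rpow_of_nonneg _ _ (by norm_num), ENNReal.prod_rpow_of_nonneg (by norm_num)]

/-- An exponential Markov inequality: on `A` the factor `exp(-r/8 + ∑ n(θ_i - θ₀_i)²/8)` is at least
one, and its integral factorizes over coordinates. -/
theorem sliceMass_div_marginal_le (hn : 1 ≤ n) (h : IsLogLipschitz C g)
    {A : Set (ℕ × (ℕ → ℝ))} {k : ℕ} {θ₀ : ℕ → ℝ} {r : ℝ}
    (hA : ∀ θ : ℕ → ℝ, (∀ i, k ≤ i → θ i = 0) → (k, θ) ∈ A →
      r ≤ ∑ i ∈ Finset.range k, (n : ℝ) * (θ i - θ₀ i) ^ 2) (x : ℕ → ℝ) :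
    sliceMass n g A k x / marginal n g k x ≤ ENNReal.ofReal (Real.exp (-(r / 8))) *
      ∏ i ∈ Finset.range k,
        expMoment g (√(n : ℝ) * θ₀ i) (√(n : ℝ) * x i) / evidence g (√(n : ℝ) * x i) := by
  set φ : ℕ → ℝ → ℝ≥0∞ := fun i θ =>
    ENNReal.ofReal (Real.exp ((n : ℝ) * (θ - θ₀ i) ^ 2 / 8)) *
      ENNReal.ofReal (Real.exp ((n : ℝ) * (θ * x i - θ ^ 2 / 2)))
  have hφ : ∀ i, Measurable (φ i) := fun i => by fun_prop
  have h1 : sliceMass n g A k x ≤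
      ∫⁻ θ, ENNReal.ofReal (Real.exp (-(r / 8))) * ∏ i ∈ Finset.range k, φ i (θ i)
        ∂condPrior n g k := by
    refine lintegral_mono_ae ?_
    have h2 : ∀ᵐ θ ∂condPrior n g k, ∀ i, k ≤ i → θ i = 0 := by
      rw [condPrior, ae_map_iff (measurable_extendZero k).aemeasurable]
      · exact Filter.Eventually.of_forall fun t i hi => by simp [extendZero, hi]
      · simp_rw [Set.ofPred_forall]
        exact MeasurableSet.iInter fun i => MeasurableSet.iInter fun _ =>
          measurableSet_eq_fun (measurable_pi_apply i) measurable_const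
    filter_upwards [h2] with θ hθ
    by_cases hm : (k, θ) ∈ A
    · rw [Set.indicator_of_mem hm, likelihood_eq_prod]
      simp only [φ, Finset.prod_mul_distrib]
      rw [← mul_assoc]
      refine le_mul_of_one_le_left zero_le ?_
      rw [← ENNReal.ofReal_prod_of_nonneg fun _ _ => (Real.exp_pos _).le,
        ← ENNReal.ofReal_mul (Real.exp_pos _).le, ← Real.exp_sum, ← Real.exp_add,
        ENNReal.one_le_ofReal, ← Finset.sum_div]
      exact Real.one_le_exp (by linarith [hA θ hθ hm])
    · rw [Set.indicator_of_notMem hm]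
      exact zero_le
  rw [lintegral_const_mul _ (by fun_prop), lintegral_prod_condPrior n k h.density hφ] at h1
  have h3 : ∀ i, ∫⁻ t, φ i (t / √(n : ℝ)) * ENNReal.ofReal (g t) =
      expMoment g (√(n : ℝ) * θ₀ i) (√(n : ℝ) * x i) := fun i => by
    refine lintegral_congr fun t => ?_
    have h0 : (0 : ℝ) < √(n : ℝ) := Real.sqrt_pos.2 (by exact_mod_cast hn)
    have h4 : (n : ℝ) * (t / √(n : ℝ) - θ₀ i) ^ 2 / 8 = (t - √(n : ℝ) * θ₀ i) ^ 2 / 8 := by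
      have h5 : (n : ℝ) = √(n : ℝ) ^ 2 := (Real.sq_sqrt (Nat.cast_nonneg n)).symm
      nth_rewrite 1 [h5]
      field_simp
    simp only [φ]
    rw [scaled_exponent hn, h4, mul_assoc]
  simp_rw [h3] at h1
  refine (ENNReal.div_le_div h1 le_rfl).trans (le_of_eq ?_)
  rw [mul_div_assoc, marginal, ENNReal.prod_div_distrib]
  intro i _ j _ _
  exact Or.inr (h.evidence_ne_top _)

theorem lintegral_prod_law (hn : 1 ≤ n) (θ : ℕ → ℝ) (s : Finset ℕ) {f : ℕ → ℝ → ℝ≥0∞}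
    (hf : ∀ i, Measurable (f i)) :
    ∫⁻ x, ∏ i ∈ s, f i (√(n : ℝ) * x i) ∂law n θ =
      ∏ i ∈ s, ∫⁻ y, f i y ∂gaussianReal (√(n : ℝ) * θ i) 1 := by
  have hm : ∀ i, Measurable fun y => f i (√(n : ℝ) * y) := fun i => by fun_prop
  have hind : iIndepFun (fun i (x : ℕ → ℝ) => f i (√(n : ℝ) * x i)) (law n θ) :=
    iIndepFun_infinitePi (P := fun i => gaussianReal (θ i) ((n : ℝ≥0)⁻¹)) hm
  rw [lintegral_prod_eq_prod_lintegral_of_indepFun s _ hind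
    (fun i => (hm i).comp (measurable_pi_apply i))]
  refine Finset.prod_congr rfl fun i _ => ?_
  have e : (law n θ).map (fun x => x i) = gaussianReal (θ i) ((n : ℝ≥0)⁻¹) :=
    Measure.infinitePi_map_eval _ i
  have e2 : gaussianReal (√(n : ℝ) * θ i) 1 =
      (gaussianReal (θ i) ((n : ℝ≥0)⁻¹)).map (√(n : ℝ) * ·) := by
    rw [gaussianReal_map_const_mul]
    congr 1
    have : (n : ℝ≥0) ≠ 0 := by positivity
    ext
    simp [Real.sq_sqrt (Nat.cast_nonneg n)]
    field_simp
  rw [e2, lintegral_map (hf i) (by fun_prop), ← e,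
    lintegral_map (hm i) (measurable_pi_apply i)]

end GaussianSequence
end

/-! ### Expected mass of the slices under the true law. -/

noncomputable section

namespace GaussianSequence

variable {n : ℕ} {π : PMF ℕ} {g : ℝ → ℝ} {C : ℝ}

theorem measurable_posteriorSlice (hg : IsPosDensity g) {A : Set (ℕ × (ℕ → ℝ))}
    (hA : MeasurableSet A) (k : ℕ) : Measurable (posteriorSlice n π g A k) := by
  have := isProbabilityMeasure_coordPrior n hg
  have h1 : Measurable (sliceMass n g A k) := by
    have : SFinite (condPrior n g k) := by
      unfold condPrior
      infer_instance
    unfold sliceMass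
    refine Measurable.lintegral_prod_right' (f := fun p : (ℕ → ℝ) × (ℕ → ℝ) =>
      A.indicator (fun q => likelihood n q p.1) (k, p.2)) ?_
    have h2 : Measurable fun p : (ℕ → ℝ) × (ℕ → ℝ) => likelihood n (k, p.2) p.1 :=
      (Real.measurable_exp.comp (Finset.measurable_sum (Finset.range k) fun i _ =>
        by fun_prop)).ennreal_ofReal
    have h3 : MeasurableSet {p : (ℕ → ℝ) × (ℕ → ℝ) | (k, p.2) ∈ A} :=
      hA.preimage (measurable_const.prodMk measurable_snd)
    convert! h2.indicator h3 using 2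
  have h2 : ∀ j, Measurable (marginal n g j) := fun j => by
    have := measurable_evidence hg.measurable
    unfold marginal
    fun_prop
  exact (h1.const_mul _).div (Measurable.tsum fun j => (h2 j).const_mul _)

theorem lintegral_posterior_eq (hn : 1 ≤ n) (hg : IsPosDensity g) {A : Set (ℕ × (ℕ → ℝ))}
    (hA : MeasurableSet A) (θ₀ : ℕ → ℝ) (K : ℕ) :
    ∫⁻ x, posterior n π g A x ∂law n θ₀ =
      ∑ k ∈ Finset.range K, ∫⁻ x, posteriorSlice n π g A k x ∂law n θ₀ +
        ∑' j, ∫⁻ x, posteriorSlice n π g A (j + K) x ∂law n θ₀ := by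
  simp_rw [posterior_eq_tsum hn π hg hA]
  rw [lintegral_tsum fun k => (measurable_posteriorSlice hg hA k).aemeasurable]
  exact (ENNReal.summable.sum_add_tsum_nat_add' (k := K)).symm

theorem sq_scaled (n : ℕ) (t : ℝ) : (√(n : ℝ) * t) ^ 2 = n * t ^ 2 := by
  rw [mul_pow, Real.sq_sqrt (Nat.cast_nonneg n)]

theorem lintegral_posteriorSlice_le_of_ge (hn : 1 ≤ n) (h : IsLogLipschitz C g)
    (A : Set (ℕ × (ℕ → ℝ))) {k J : ℕ} (hkJ : J ≤ k) (θ₀ : ℕ → ℝ) (hJ : π J ≠ 0) :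
    ∫⁻ x, posteriorSlice n π g A k x ∂law n θ₀ ≤ (π k / π J) ^ (1 / 2 : ℝ) *
      ENNReal.ofReal (Real.exp ((∑ i ∈ Finset.Ico J k, (n : ℝ) * θ₀ i ^ 2) / 2)) := by
  have hm := measurable_evidence h.density.measurable
  refine (lintegral_mono (posteriorSlice_le_of_ge hn h A hkJ)).trans ?_
  rw [lintegral_const_mul' _ _ (ENNReal.rpow_ne_top_of_nonneg (by norm_num)
    (ENNReal.div_ne_top (π.apply_ne_top k) hJ)), lintegral_prod_law hn θ₀ _
    (f := fun _ y => evidence g y ^ (1 / 2 : ℝ)) (fun _ => by fun_prop)]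
  refine mul_le_mul_right ?_ _
  rw [Finset.sum_div, Real.exp_sum, ENNReal.ofReal_prod_of_nonneg fun _ _ => (Real.exp_pos _).le]
  refine Finset.prod_le_prod' fun i _ => ?_
  rw [← sq_scaled]
  exact lintegral_sqrt_evidence_le h.density _

theorem lintegral_posteriorSlice_le_of_le (hn : 1 ≤ n) (h : IsLogLipschitz C g)
    (A : Set (ℕ × (ℕ → ℝ))) {k J : ℕ} (hkJ : k ≤ J) (θ₀ : ℕ → ℝ) (hJ : π J ≠ 0) :
    ∫⁻ x, posteriorSlice n π g A k x ∂law n θ₀ ≤ (π J)⁻¹ *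
      ENNReal.ofReal (Real.exp (∑ i ∈ Finset.Ico k J,
        (evidenceExponent C - n * θ₀ i ^ 2 / 6))) := by
  have hm := measurable_evidence h.density.measurable
  refine (lintegral_mono (posteriorSlice_le_of_le hn h A hkJ)).trans ?_
  rw [lintegral_const_mul' _ _ (ENNReal.inv_ne_top.2 hJ), lintegral_prod_law hn θ₀ _
    (f := fun _ y => (evidence g y)⁻¹) (fun _ => by fun_prop)]
  refine mul_le_mul_right ?_ _
  rw [Real.exp_sum, ENNReal.ofReal_prod_of_nonneg fun _ _ => (Real.exp_pos _).le]
  refine Finset.prod_le_prod' fun i _ => ?_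
  rw [← sq_scaled]
  exact h.lintegral_evidence_inv_le _

theorem lintegral_posteriorSlice_le_of_far (hn : 1 ≤ n) (hC : 0 ≤ C) (h : IsLogLipschitz C g)
    {A : Set (ℕ × (ℕ → ℝ))} {k : ℕ} {θ₀ : ℕ → ℝ} {r : ℝ}
    (hA : ∀ θ : ℕ → ℝ, (∀ i, k ≤ i → θ i = 0) → (k, θ) ∈ A →
      r ≤ ∑ i ∈ Finset.range k, (n : ℝ) * (θ i - θ₀ i) ^ 2) :
    ∫⁻ x, posteriorSlice n π g A k x ∂law n θ₀ ≤
      ENNReal.ofReal (Real.exp (k * evidenceExponent C - r / 8)) := by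
  have hm := measurable_evidence h.density.measurable
  have hm' := measurable_expMoment h.density.measurable
  refine (lintegral_mono fun x => (posteriorSlice_le_sliceMass_div A k x).trans
    (sliceMass_div_marginal_le hn h hA x)).trans ?_
  rw [lintegral_const_mul' _ _ ENNReal.ofReal_ne_top, lintegral_prod_law hn θ₀ _
    (f := fun i y => expMoment g (√(n : ℝ) * θ₀ i) y / evidence g y) (fun _ => by fun_prop)]
  have h1 : ∏ i ∈ Finset.range k, ∫⁻ y, expMoment g (√(n : ℝ) * θ₀ i) y / evidence g y
      ∂gaussianReal (√(n : ℝ) * θ₀ i) 1 ≤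
      ∏ _i ∈ Finset.range k, ENNReal.ofReal (Real.exp (evidenceExponent C)) :=
    Finset.prod_le_prod' fun i _ => h.lintegral_expMoment_div_evidence_le hC _
  refine (mul_le_mul_right h1 _).trans (le_of_eq ?_)
  rw [Finset.prod_const, Finset.card_range, ← ENNReal.ofReal_pow (Real.exp_pos _).le,
    ← Real.exp_nat_mul, ← ENNReal.ofReal_mul (Real.exp_pos _).le, ← Real.exp_add]
  congr 2
  ring

/-! ### Rate identities, Sobolev tails and the prior on the dimension. -/

theorem one_le_effDim {α : ℝ} (hα : 0 < α) (hn : 1 ≤ n) : 1 ≤ effDim α n :=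
  Real.one_le_rpow (by exact_mod_cast hn) (by positivity)

theorem mul_rateSq {α : ℝ} (hα : 0 < α) (hn : 1 ≤ n) : n * rateSq α n = effDim α n := by
  have h0 : (0 : ℝ) < n := by exact_mod_cast hn
  rw [rateSq, effDim]
  nth_rewrite 1 [← Real.rpow_one (n : ℝ)]
  rw [← Real.rpow_add h0]
  congr 1
  field_simp
  ring

theorem effDim_mul_rpow {α : ℝ} (hα : 0 < α) (hn : 1 ≤ n) :
    effDim α n * effDim α n ^ (2 * α) = n := by
  have h0 : (0 : ℝ) < n := by exact_mod_cast hn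
  rw [effDim, ← Real.rpow_mul h0.le, ← Real.rpow_add h0]
  nth_rewrite 2 [← Real.rpow_one (n : ℝ)]
  congr 1
  field_simp
  ring

theorem sum_sq_le_of_mem_sobolevBall {α Q : ℝ} (hα : 0 < α) (hn : 1 ≤ n) {θ : ℕ → ℝ}
    (hθ : θ ∈ sobolevBall α Q) {s : Finset ℕ} (hs : ∀ i ∈ s, ⌊effDim α n⌋₊ ≤ i) :
    ∑ i ∈ s, (n : ℝ) * θ i ^ 2 ≤ Q ^ 2 * effDim α n := by
  have hm := one_le_effDim hα hn
  have h1 : ∀ i ∈ s, (n : ℝ) * θ i ^ 2 ≤ effDim α n * (((i : ℝ) + 1) ^ (2 * α) * θ i ^ 2) := by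
    intro i hi
    rw [← effDim_mul_rpow hα hn, mul_assoc]
    -- Index `i` carries the weight `(i+1)^{2α}`, so the integer part `⌊m⌋ ≤ i` still yields `m ≤ i
    -- + 1`.
    have h2 : effDim α n ≤ (i : ℝ) + 1 :=
      (Nat.lt_floor_add_one _).le.trans (by exact_mod_cast Nat.succ_le_succ (hs i hi))
    have h3 := Real.rpow_le_rpow (by linarith) h2 (show 0 ≤ 2 * α by positivity)
    gcongr
  refine (Finset.sum_le_sum h1).trans ?_
  rw [← Finset.mul_sum, mul_comm]
  refine mul_le_mul_of_nonneg_right ?_ (by linarith)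
  exact (hθ.1.sum_le_tsum s fun i _ => by positivity).trans hθ.2

theorem pmf_le_pow {c : ℝ} (hc : 0 < c)
    (h : ∀ j : ℕ, 1 ≤ j → π (j + 1) ≤ ENNReal.ofReal c * π j) (j : ℕ) :
    π (j + 1) ≤ ENNReal.ofReal (c ^ j) := by
  induction j with
  -- The recursion starts at `1`, since nothing is assumed about `π 0`; hence the exponent `j` at `j
  -- + 1`.
  | zero => simpa using π.coe_le_one 1
  | succ j ih =>
    refine (h (j + 1) (by omega)).trans ((mul_le_mul_right ih _).trans (le_of_eq ?_))
    rw [← ENNReal.ofReal_mul hc.le, pow_succ']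

theorem pmf_inv_le {J : ℕ} {r : ℝ} (hJ : π J ≠ 0) (h : -Real.log (π J).toReal ≤ r) :
    (π J)⁻¹ ≤ ENNReal.ofReal (Real.exp r) := by
  have h0 : 0 < (π J).toReal := ENNReal.toReal_pos hJ (π.apply_ne_top J)
  rw [← ENNReal.ofReal_toReal (π.apply_ne_top J), ← ENNReal.ofReal_inv_of_pos h0]
  refine ENNReal.ofReal_le_ofReal ?_
  rw [← Real.exp_log h0, ← Real.exp_neg]
  exact Real.exp_le_exp.2 h

/-- The conditions on the prior: `π` decays geometrically and is not too small at the effective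
dimension, and `g` is log-Lipschitz at large scales. -/
structure IsAdmissiblePrior (α c C : ℝ) (n : ℕ) (π : PMF ℕ) (g : ℝ → ℝ) : Prop where
  decay : ∀ j : ℕ, 1 ≤ j → π (j + 1) ≤ ENNReal.ofReal c * π j
  ne_zero : π ⌊effDim α n⌋₊ ≠ 0
  neg_log_le : -Real.log (π ⌊effDim α n⌋₊).toReal ≤ C * effDim α n
  logLipschitz : IsLogLipschitz C g

/-- The multiple of the effective dimension beyond which the posterior puts negligible mass. -/
def dimConst (Q c C : ℝ) : ℝ :=
  1 + ((C + Q ^ 2) / 2 + 2 + -Real.log √c - Real.log (1 - √c)) / -Real.log √c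

/-! ### Dimensions far above the effective dimension. -/

section Tail

variable {α Q c : ℝ}

theorem sqrt_lt_one_of_lt_one (hc1 : c < 1) : √c < 1 := (Real.sqrt_lt' one_pos).2 (by simpa using hc1)

theorem one_le_dimConst (hc : 0 < c) (hc1 : c < 1) (hC : 0 < C) : 1 ≤ dimConst Q c C := by
  have h0 : 0 < √c := Real.sqrt_pos.2 hc
  have h1 := Real.log_neg h0 (sqrt_lt_one_of_lt_one hc1)
  have h2 := Real.log_nonpos (x := 1 - √c) (by linarith [sqrt_lt_one_of_lt_one hc1]) (by linarith)
  have h3 : 0 ≤ (C + Q ^ 2) / 2 := by positivity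
  have : 0 ≤ ((C + Q ^ 2) / 2 + 2 + -Real.log √c - Real.log (1 - √c)) / -Real.log √c :=
    div_nonneg (by linarith) (by linarith)
  rw [dimConst]
  linarith

/-- This fixes `dimConst`: its numerator pays for `exp((C + Q²)m/2)`, for the target `2m`, for the
factor `√c` lost to the floor, and for the geometric sum `(1 - √c)⁻¹`. Since `m ≥ 1`, constant costs
may be multiplied by `m`. -/
theorem tail_exponent_le (hc : 0 < c) (hc1 : c < 1) {m : ℝ} (hm : 1 ≤ m) :
    Real.exp ((C + Q ^ 2) / 2 * m) * (√c ^ ⌊dimConst Q c C * m⌋₊ * (1 - √c)⁻¹) ≤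
      Real.exp (-(2 * m)) := by
  have h0 : 0 < √c := Real.sqrt_pos.2 hc
  have h1 := Real.log_neg h0 (sqrt_lt_one_of_lt_one hc1)
  have h2 : 0 < 1 - √c := by linarith [sqrt_lt_one_of_lt_one hc1]
  have h3 := Real.log_nonpos h2.le (by linarith)
  rw [← Real.exp_log h0, ← Real.exp_nat_mul, Real.exp_log h0]
  rw [← Real.exp_log h2, ← Real.exp_neg, ← Real.exp_add, ← Real.exp_add]
  refine Real.exp_le_exp.2 ?_
  have h4 : dimConst Q c C * m - 1 ≤ ⌊dimConst Q c C * m⌋₊ := (Nat.sub_one_lt_floor _).le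
  have h5 := mul_le_mul_of_nonpos_right h4 h1.le
  have h6 : dimConst Q c C * Real.log √c =
      Real.log √c - ((C + Q ^ 2) / 2 + 2 + -Real.log √c - Real.log (1 - √c)) := by
    have h7 := h1.ne
    rw [dimConst]
    generalize Real.log √c = l at h7
    field_simp
    ring
  have h8 : (dimConst Q c C * m - 1) * Real.log √c =
      (dimConst Q c C * Real.log √c) * m - Real.log √c := by ring
  rw [h8, h6] at h5
  nlinarith

/-- The set `A` is arbitrary, so the same bound serves both the dimension and the distance
statement. -/
theorem tsum_tail_le (hα : 0 < α) (hc : 0 < c) (hc1 : c < 1) (hC : 0 < C) (hn : 1 ≤ n)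
    (h : IsAdmissiblePrior α c C n π g) {θ₀ : ℕ → ℝ} (hθ : θ₀ ∈ sobolevBall α Q)
    (A : Set (ℕ × (ℕ → ℝ))) :
    ∑' j, ∫⁻ x, posteriorSlice n π g A (j + (⌊dimConst Q c C * effDim α n⌋₊ + 1)) x ∂law n θ₀ ≤
      ENNReal.ofReal (Real.exp (-(2 * effDim α n))) := by
  have hm := one_le_effDim hα hn
  set m := effDim α n
  set K := ⌊dimConst Q c C * m⌋₊
  have hJK : ⌊m⌋₊ ≤ K :=
    Nat.floor_le_floor (le_mul_of_one_le_left (by linarith) (one_le_dimConst hc hc1 hC))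
  have hs : 0 ≤ √c := Real.sqrt_nonneg c
  have h1 : ∀ j, ∫⁻ x, posteriorSlice n π g A (j + (K + 1)) x ∂law n θ₀ ≤
      ENNReal.ofReal (Real.exp ((C + Q ^ 2) / 2 * m) * √c ^ K * √c ^ j) := by
    intro j
    refine (lintegral_posteriorSlice_le_of_ge hn h.logLipschitz A (J := ⌊m⌋₊) (by omega) θ₀
      h.ne_zero).trans ?_
    have h2 : π (j + (K + 1)) / π ⌊m⌋₊ ≤ ENNReal.ofReal (c ^ (j + K) * Real.exp (C * m)) := by
      rw [div_eq_mul_inv, ENNReal.ofReal_mul (by positivity)]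
      exact mul_le_mul' (pmf_le_pow hc h.decay (j + K)) (pmf_inv_le h.ne_zero h.neg_log_le)
    refine (mul_le_mul_left (ENNReal.rpow_le_rpow h2 (by norm_num)) _).trans ?_
    rw [ENNReal.ofReal_rpow_of_nonneg (by positivity) (by norm_num),
      ← ENNReal.ofReal_mul (by positivity)]
    refine ENNReal.ofReal_le_ofReal ?_
    rw [← Real.sqrt_eq_rpow, Real.sqrt_mul (by positivity), ← Real.exp_half]
    have h3 : √(c ^ (j + K)) = √c ^ (j + K) := by
      rw [Real.sqrt_eq_iff_eq_sq (by positivity) (by positivity), ← pow_mul, mul_comm,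
        pow_mul, Real.sq_sqrt hc.le]
    have h4 := sum_sq_le_of_mem_sobolevBall hα hn hθ (s := Finset.Ico ⌊m⌋₊ (j + (K + 1)))
      fun i hi => (Finset.mem_Ico.1 hi).1
    rw [h3, mul_assoc, ← Real.exp_add, mul_comm, pow_add, mul_assoc, mul_comm (√c ^ K)]
    refine mul_le_mul_of_nonneg_right (Real.exp_le_exp.2 ?_) (by positivity)
    linarith
  refine (ENNReal.tsum_le_tsum h1).trans ?_
  rw [← ENNReal.ofReal_tsum_of_nonneg (fun j => by positivity)
    ((summable_geometric_of_lt_one hs (sqrt_lt_one_of_lt_one hc1)).mul_left _), tsum_mul_left,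
    tsum_geometric_of_lt_one hs (sqrt_lt_one_of_lt_one hc1), mul_assoc]
  exact ENNReal.ofReal_le_ofReal (tail_exponent_le hc hc1 hm)

end Tail

/-! ### Contraction in squared distance, and the two posterior bounds. -/

section Distance

variable {α Q : ℝ}

theorem measurableSet_sqDist_ge (θ₀ : ℕ → ℝ) (r : ℝ≥0∞) :
    MeasurableSet {p : ℕ × (ℕ → ℝ) | r ≤ sqDist p.2 θ₀} := by
  refine measurableSet_le measurable_const ?_
  unfold sqDist
  exact Measurable.tsum fun i => by fun_prop

/-- The squared distance splits into the error on active coordinates, the signal omitted below `J`,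
and the Sobolev tail from `J` on. For `k > J` the ranges overlap, which is harmless in an upper
bound. -/
theorem le_sum_of_le_sqDist (hα : 0 < α) (hn : 1 ≤ n) {θ θ₀ : ℕ → ℝ} {k : ℕ} {M : ℝ}
    (hθ₀ : θ₀ ∈ sobolevBall α Q) (hθ : ∀ i, k ≤ i → θ i = 0)
    (h : ENNReal.ofReal (M * rateSq α n) ≤ sqDist θ θ₀) :
    M * effDim α n ≤ ∑ i ∈ Finset.range k, (n : ℝ) * (θ i - θ₀ i) ^ 2 +
      ∑ i ∈ Finset.Ico k ⌊effDim α n⌋₊, (n : ℝ) * θ₀ i ^ 2 + Q ^ 2 * effDim α n := by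
  have hn0 : (0 : ℝ) < n := by exact_mod_cast hn
  have hm := one_le_effDim hα hn
  set J := ⌊effDim α n⌋₊
  set R := ∑ i ∈ Finset.range k, (n : ℝ) * (θ i - θ₀ i) ^ 2 +
      ∑ i ∈ Finset.Ico k J, (n : ℝ) * θ₀ i ^ 2 + Q ^ 2 * effDim α n with hR
  have hR0 : 0 ≤ R := by positivity
  have h1 : sqDist θ θ₀ ≤ ENNReal.ofReal (R / n) := by
    refine ENNReal.tsum_le_of_sum_range_le fun N => ?_
    rw [← ENNReal.ofReal_sum_of_nonneg fun i _ => sq_nonneg _]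
    refine ENNReal.ofReal_le_ofReal ((le_div_iff₀' hn0).2 ?_)
    rw [Finset.mul_sum]
    have h2 : ∀ i ∈ Finset.range N, (n : ℝ) * (θ i - θ₀ i) ^ 2 ≤
        (if i < k then (n : ℝ) * (θ i - θ₀ i) ^ 2 else 0) +
        (if k ≤ i ∧ i < J then (n : ℝ) * θ₀ i ^ 2 else 0) +
        (if J ≤ i then (n : ℝ) * θ₀ i ^ 2 else 0) := by
      intro i _
      have h3 : 0 ≤ (n : ℝ) * θ₀ i ^ 2 := by positivity
      by_cases hik : i < k
      · rw [if_pos hik]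
        split_ifs <;> linarith
      · have h4 := hθ i (not_lt.1 hik)
        rw [if_neg hik, h4, zero_sub, neg_sq]
        by_cases hiJ : i < J
        · rw [if_pos ⟨not_lt.1 hik, hiJ⟩]
          split_ifs <;> linarith
        · rw [if_pos (not_lt.1 hiJ)]
          split_ifs <;> linarith
    refine (Finset.sum_le_sum h2).trans ?_
    rw [Finset.sum_add_distrib, Finset.sum_add_distrib, ← Finset.sum_filter, ← Finset.sum_filter,
      ← Finset.sum_filter]
    refine add_le_add (add_le_add ?_ ?_) ?_
    · refine Finset.sum_le_sum_of_subset_of_nonneg (fun i hi => ?_) fun i _ _ => by positivity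
      simp at hi ⊢
      exact hi.2
    · refine Finset.sum_le_sum_of_subset_of_nonneg (fun i hi => ?_) fun i _ _ => by positivity
      simp at hi ⊢
      exact hi.2
    · exact sum_sq_le_of_mem_sobolevBall hα hn hθ₀ fun i hi => (Finset.mem_filter.1 hi).2
  have h2 := (ENNReal.ofReal_le_ofReal_iff (by positivity)).1 (h.trans h1)
  rw [le_div_iff₀ hn0, mul_assoc, mul_comm (rateSq α n), mul_rateSq hα hn] at h2
  exact h2

/-- The multiple of the squared rate beyond which the posterior puts negligible mass. -/
def rateConst (Q c C : ℝ) : ℝ :=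
  dimConst Q c C + 16 * (evidenceExponent C * dimConst Q c C + dimConst Q c C + 3) +
    12 * (C + evidenceExponent C + dimConst Q c C + 3) + 2 * Q ^ 2

variable {c : ℝ}

theorem lintegral_posteriorSlice_sqDist_le (hα : 0 < α) (hc : 0 < c) (hc1 : c < 1) (hC : 0 < C)
    (hn : 1 ≤ n) (h : IsAdmissiblePrior α c C n π g) {θ₀ : ℕ → ℝ} (hθ : θ₀ ∈ sobolevBall α Q)
    {k : ℕ} (hk : (k : ℝ) ≤ dimConst Q c C * effDim α n) :
    ∫⁻ x, posteriorSlice n π g {p | ENNReal.ofReal (rateConst Q c C * rateSq α n) ≤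
      sqDist p.2 θ₀} k x ∂law n θ₀ ≤
        ENNReal.ofReal (Real.exp (-((dimConst Q c C + 3) * effDim α n))) := by
  have hm := one_le_effDim hα hn
  have hd := one_le_dimConst (Q := Q) hc hc1 hC
  have hb : 0 < evidenceExponent C := by
    unfold evidenceExponent
    positivity
  have hbd : 0 < evidenceExponent C * dimConst Q c C := by positivity
  have hM : rateConst Q c C = dimConst Q c C +
    16 * (evidenceExponent C * dimConst Q c C + dimConst Q c C + 3) +
    12 * (C + evidenceExponent C + dimConst Q c C + 3) + 2 * Q ^ 2 := rfl
  set m := effDim α n with hmdef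
  set d := dimConst Q c C
  set b := evidenceExponent C
  set M := rateConst Q c C
  have hQm : 0 ≤ Q ^ 2 * m := by positivity
  -- Either the omitted signal takes up half of `M m`, up to the tail `Q² m`, or the active
  -- coordinates must contribute at least `M m / 2`.
  by_cases hs : (M / 2 - Q ^ 2) * m ≤ ∑ i ∈ Finset.Ico k ⌊m⌋₊, (n : ℝ) * θ₀ i ^ 2
  · have hpos : 0 < (M / 2 - Q ^ 2) * m := mul_pos (by linarith) (by linarith)
    have hkJ : k ≤ ⌊m⌋₊ := by
      by_contra hcon
      rw [Finset.Ico_eq_empty (by omega), Finset.sum_empty] at hs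
      linarith
    refine (lintegral_posteriorSlice_le_of_le hn h.logLipschitz _ hkJ θ₀ h.ne_zero).trans ?_
    refine (mul_le_mul_left (pmf_inv_le h.ne_zero h.neg_log_le) _).trans ?_
    rw [← ENNReal.ofReal_mul (Real.exp_pos _).le, ← Real.exp_add]
    refine ENNReal.ofReal_le_ofReal (Real.exp_le_exp.2 ?_)
    rw [Finset.sum_sub_distrib, ← Finset.sum_div, Finset.sum_const, Nat.card_Ico, nsmul_eq_mul]
    have h1 : ((⌊m⌋₊ - k : ℕ) : ℝ) ≤ m :=
      (Nat.cast_le.2 (Nat.sub_le _ _)).trans (Nat.floor_le (by linarith))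
    have h2 := mul_le_mul_of_nonneg_right h1 hb.le
    -- The `12` in `rateConst` is `2 * 6`: half of `M`, times the rate `1/6` of the inverse evidence
    -- bound.
    have h3 : 12 * (C + b + d + 3) * m ≤ (M - 2 * Q ^ 2) * m :=
      mul_le_mul_of_nonneg_right (by linarith) (by linarith)
    rw [← hmdef]
    linarith
  · refine (lintegral_posteriorSlice_le_of_far hn hC.le h.logLipschitz (r := M / 2 * m)
      fun θ hz hA => ?_).trans ?_
    · have := le_sum_of_le_sqDist hα hn hθ hz hA
      rw [← hmdef] at this
      linarith
    · refine ENNReal.ofReal_le_ofReal (Real.exp_le_exp.2 ?_)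
      have h1 := mul_le_mul_of_nonneg_right hk hb.le
      -- The `16` is `2 * 8`: half of `M`, times the rate `1/8` of the exponential moment.
      have h2 : 16 * (b * d + d + 3) * m ≤ M * m :=
        mul_le_mul_of_nonneg_right (by linarith [sq_nonneg Q]) (by linarith)
      linarith

theorem lintegral_posterior_sqDist_le (hα : 0 < α) (hc : 0 < c) (hc1 : c < 1) (hC : 0 < C)
    (hn : 1 ≤ n) (h : IsAdmissiblePrior α c C n π g) {θ₀ : ℕ → ℝ} (hθ : θ₀ ∈ sobolevBall α Q) :
    ∫⁻ x, posterior n π g {p | ENNReal.ofReal (rateConst Q c C * rateSq α n) ≤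
      sqDist p.2 θ₀} x ∂law n θ₀ ≤ ENNReal.ofReal (Real.exp (-effDim α n)) := by
  have hm := one_le_effDim hα hn
  have hd := one_le_dimConst (Q := Q) hc hc1 hC
  have hdm : 0 ≤ dimConst Q c C * effDim α n := by positivity
  rw [lintegral_posterior_eq hn h.logLipschitz.density (measurableSet_sqDist_ge θ₀ _) θ₀
    (⌊dimConst Q c C * effDim α n⌋₊ + 1)]
  have h1 := Finset.sum_le_card_nsmul (Finset.range (⌊dimConst Q c C * effDim α n⌋₊ + 1))
    (fun k => ∫⁻ x, posteriorSlice n π g {p | ENNReal.ofReal (rateConst Q c C * rateSq α n) ≤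
      sqDist p.2 θ₀} k x ∂law n θ₀) _ fun k hk =>
    lintegral_posteriorSlice_sqDist_le hα hc hc1 hC hn h hθ
      ((Nat.cast_le.2 (Nat.lt_succ_iff.1 (Finset.mem_range.1 hk))).trans (Nat.floor_le hdm))
  refine (add_le_add h1 (tsum_tail_le hα hc hc1 hC hn h hθ _)).trans ?_
  rw [Finset.card_range, ← ENNReal.ofReal_nsmul, ← ENNReal.ofReal_add (by positivity)
    (by positivity)]
  refine ENNReal.ofReal_le_ofReal ?_
  set m := effDim α n
  set d := dimConst Q c C
  -- The number of slices is at most `exp((d+1)m)`; the rate `d + 3` per slice therefore leaves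
  -- `exp(-2m)` in total.
  have h2 : ((⌊d * m⌋₊ + 1 : ℕ) : ℝ) ≤ Real.exp ((d + 1) * m) := by
    push_cast
    have := Nat.floor_le hdm
    have := Real.add_one_le_exp ((d + 1) * m)
    linarith
  have h3 : ((⌊d * m⌋₊ + 1 : ℕ) : ℝ) * Real.exp (-((d + 3) * m)) ≤ Real.exp (-(2 * m)) := by
    refine (mul_le_mul_of_nonneg_right h2 (Real.exp_pos _).le).trans (le_of_eq ?_)
    rw [← Real.exp_add]
    congr 1
    ring
  have h4 : Real.exp (-m) = Real.exp m * Real.exp (-(2 * m)) := by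
    rw [← Real.exp_add]
    congr 1
    ring
  rw [nsmul_eq_mul, h4]
  have h5 := Real.add_one_le_exp m
  have h6 := Real.exp_pos (-(2 * m))
  -- Two terms `exp(-2m)` fit into `exp(-m)` because `exp m ≥ m + 1 ≥ 2`.
  nlinarith

theorem lintegral_posterior_dim_le (hα : 0 < α) (hc : 0 < c) (hc1 : c < 1) (hC : 0 < C)
    (hn : 1 ≤ n) (h : IsAdmissiblePrior α c C n π g) {θ₀ : ℕ → ℝ} (hθ : θ₀ ∈ sobolevBall α Q)
    {M : ℝ} (hM : dimConst Q c C ≤ M) :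
    ∫⁻ x, posterior n π g {p | M * effDim α n < (p.1 : ℝ)} x ∂law n θ₀ ≤
      ENNReal.ofReal (Real.exp (-effDim α n)) := by
  have hm := one_le_effDim hα hn
  have hd := one_le_dimConst (Q := Q) hc hc1 hC
  have hdm : 0 ≤ dimConst Q c C * effDim α n := by positivity
  have hA : MeasurableSet {p : ℕ × (ℕ → ℝ) | M * effDim α n < (p.1 : ℝ)} :=
    measurableSet_lt measurable_const (by fun_prop)
  rw [lintegral_posterior_eq hn h.logLipschitz.density hA θ₀
    (⌊dimConst Q c C * effDim α n⌋₊ + 1), Finset.sum_eq_zero, zero_add]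
  · refine (tsum_tail_le hα hc hc1 hC hn h hθ _).trans
      (ENNReal.ofReal_le_ofReal (Real.exp_le_exp.2 (by linarith)))
  · intro k hk
    have h1 : (k : ℝ) ≤ M * effDim α n :=
      ((Nat.cast_le.2 (Nat.lt_succ_iff.1 (Finset.mem_range.1 hk))).trans
        (Nat.floor_le hdm)).trans (mul_le_mul_of_nonneg_right hM (by linarith))
    -- Slices with `k ≤ dimConst * m ≤ M m` miss the event, so only the tail series contributes.
    have h2 : ∀ x, posteriorSlice n π g {p | M * effDim α n < (p.1 : ℝ)} k x = 0 := fun x => by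
      have h3 : sliceMass n g {p | M * effDim α n < (p.1 : ℝ)} k x = 0 := by
        rw [sliceMass, lintegral_eq_zero_of_ae_eq_zero]
        refine Filter.Eventually.of_forall fun θ => Set.indicator_of_notMem ?_ _
        simpa using h1
      rw [posteriorSlice, h3, mul_zero, ENNReal.zero_div]
    simp [h2]

end Distance

end GaussianSequence
end

theorem theorem5p4 (α Q c C : ℝ) (hα : 0 < α) (hQ : 0 < Q) (hc : 0 < c) (hc1 : c < 1)
    (hC : 0 < C) :
    ∃ M C' : ℝ, 0 < M ∧ 0 < C' ∧
      ∀ (n : ℕ) (π : PMF ℕ) (g : ℝ → ℝ), 1 ≤ n →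
        -- the ratios of the prior on the dimension decay geometrically
        (∀ j : ℕ, 1 ≤ j → π (j + 1) ≤ ENNReal.ofReal c * π j) →
        -- the prior mass at the (integer part of the) effective dimension is not too small
        π ⌊GaussianSequence.effDim α n⌋₊ ≠ 0 →
        -Real.log (π ⌊GaussianSequence.effDim α n⌋₊).toReal
          ≤ C * GaussianSequence.effDim α n →
        GaussianSequence.IsPosDensity g →
        (∀ x y : ℝ, |Real.log (g x) - Real.log (g y)| ≤ C * (1 + |x - y|)) →
        |Real.log (g 0)| ≤ C →
        ∀ θ₀ ∈ GaussianSequence.sobolevBall α Q,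
          (∫⁻ x, GaussianSequence.posterior n π g
                {p | M * GaussianSequence.effDim α n < (p.1 : ℝ)} x
              ∂(GaussianSequence.law n θ₀)
            ≤ ENNReal.ofReal (Real.exp (-(C' * (n * GaussianSequence.rateSq α n))))) ∧
          (∫⁻ x, GaussianSequence.posterior n π g
                {p | ENNReal.ofReal (M * GaussianSequence.rateSq α n)
                  ≤ GaussianSequence.sqDist p.2 θ₀} x
              ∂(GaussianSequence.law n θ₀)
            ≤ ENNReal.ofReal (Real.exp (-(C' * (n * GaussianSequence.rateSq α n))))) := by
  have hd := GaussianSequence.one_le_dimConst (Q := Q) hc hc1 hC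
  have hM : GaussianSequence.dimConst Q c C ≤ GaussianSequence.rateConst Q c C := by
    rw [GaussianSequence.rateConst, GaussianSequence.evidenceExponent, add_assoc, add_assoc]
    refine le_add_of_nonneg_right ?_
    positivity
  -- One `M` serves both bounds because `rateConst` dominates `dimConst`; each slice estimate has
  -- enough slack for `C' = 1`.
  refine ⟨GaussianSequence.rateConst Q c C, 1, by linarith, one_pos, ?_⟩
  intro n π g hn hdecay hJ hlog hg hlip hg0 θ₀ hθ
  have h : GaussianSequence.IsAdmissiblePrior α c C n π g := ⟨hdecay, hJ, hlog, hg, hlip, hg0⟩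
  rw [one_mul, GaussianSequence.mul_rateSq hα hn]
  exact ⟨GaussianSequence.lintegral_posterior_dim_le hα hc hc1 hC hn h hθ hM,
    GaussianSequence.lintegral_posterior_sqDist_le hα hc hc1 hC hn h hθ⟩
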